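/- Let $\mathbb{X}$ be a (real or complex) Banach space with an unconditional basis $(x_j)_{j=1}^\infty$, let $(x_j^*)_{j=1}^\infty$ in $\mathbb{X}^*$ be its biorthogonal functionals, and let $\mathbb{Y}=[x_j^*\colon j\in\mathbb{N}]$ be their closed linear span in $\mathbb{X}^*$. Here $[\,\cdot\,]$ denotes the closed linear span, and $\operatorname{supp}(f)=\{j\in\mathbb{N}\colon x_j^*(f)\neq 0\}$ for $f\in\mathbb{X}$. Suppose that there are a constant $C$ and a non-decreasing sequence $(j_n)_{n=1}^\infty$ in $\mathbb{N}$ such that \[ \Bigl\Vert \sum_{n=1}^\infty f_n\Bigr\Vert \le C \Bigl\Vert \sum_{n=1}^\infty g_n\Bigr\Vert \] whenever $(f_n)_{n=1}^\infty$ and $(g_n)_{n=1}^\infty$ in $\mathbb{X}$ and a strictly increasing sequence $(k_n)_{n=1}^\infty$ in $\mathbb{N}$ are such that both series converge unconditionally and, for all $n\in\mathbb{N}$, $\Vert f_n\Vert\le\Vert g_n\Vert$, $\operatorname{supp}(f_n)\cup\operatorname{supp}(g_n)\subseteq[k_n,k_{n+1}-1]$ and $j_n\le k_n$. Given a set $\mathcal{U}$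 of infinite-dimensional Banach spaces, a Banach space $\mathbb{E}$ is called $\mathcal{U}$-subprojective if every infinite-dimensional closed subspace $\mathbb{V}$ of $\mathbb{E}$ contains an (infinite-dimensional) subspace that is complemented in $\mathbb{E}$, i.e. the range of a bounded linear projection on $\mathbb{E}$, and is isomorphic to a member of $\mathcal{U}$. Then $\mathbb{X}$ is $\mathcal{U}$-subprojective and $\mathbb{Y}$ is $\mathcal{U}^*$-subprojective, where \begin{align*} \mathcal{U}&=\{[x_{k_n}\colon n\in\mathbb{N}]\colon\ j_n\le k_n<k_{n+1}\ \text{for all } n\in\mathbb{N}\},\\ \mathcal{U}^*&=\{[x_{k_n}^*\colon n\in\mathbb{N}]\colon\ j_n\le k_n<k_{n+1}\ \text{for all } n\in\mathbb{N}\}. \end{align*} -/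

import Mathlib

namespace UncondBasis

section

variable {𝕜 : Type*} [RCLike 𝕜]
variable {X : Type*} [NormedAddCommGroup X] [NormedSpace 𝕜 X]

/-- The closed linear span `[v n : n ∈ ℕ]` of a sequence. -/
def closedSpan (v : ℕ → X) : Submodule 𝕜 X :=
  (Submodule.span 𝕜 (Set.range v)).topologicalClosure

/-- The support of a vector with respect to a basis. -/
def supp (b : UnconditionalSchauderBasis ℕ 𝕜 X) (f : X) : Set ℕ :=
  {i | b.coord i f ≠ 0}

/-- `‖∑ f n‖ ≤ C * ‖∑ g n‖` for all convergent series of vectors `f n`, `g n` with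
`‖f n‖ ≤ ‖g n‖` that are supported on consecutive intervals `[k n, k (n + 1) - 1]`,
where `k` is increasing and `j n ≤ k n`. -/
def BlockDomination (b : UnconditionalSchauderBasis ℕ 𝕜 X) (C : ℝ) (j : ℕ → ℕ) : Prop :=
  ∀ (k : ℕ → ℕ) (f g : ℕ → X) (F G : X), StrictMono k → (∀ n, j n ≤ k n) →
    (∀ n, ‖f n‖ ≤ ‖g n‖) → (∀ n, supp b (f n) ∪ supp b (g n) ⊆ Set.Ico (k n) (k (n + 1))) →
    HasSum f F → HasSum g G → ‖F‖ ≤ C * ‖G‖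

/-- The spaces `[v (k n) : n ∈ ℕ]`, where `k` is increasing and `j n ≤ k n` for all `n`. -/
def subbasisSpans (𝕜 : Type*) [RCLike 𝕜] {X : Type*} [NormedAddCommGroup X] [NormedSpace 𝕜 X]
    (v : ℕ → X) (j : ℕ → ℕ) : Set (Submodule 𝕜 X) :=
  {W | ∃ k : ℕ → ℕ, StrictMono k ∧ (∀ n, j n ≤ k n) ∧ W = closedSpan (fun n => v (k n))}

/-- `E` is `𝒰`-subprojective: every infinite-dimensional closed subspace `V` of `E` contains an
infinite-dimensional subspace `U` that is complemented in `E` and isomorphic to a member of `𝒰`.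
The members of `𝒰` are given as subspaces of a space `F`, which may differ from `E`. -/
def IsSubprojectiveFor (𝕜 : Type*) [RCLike 𝕜] (E : Type*) [NormedAddCommGroup E]
    [NormedSpace 𝕜 E] {F : Type*} [NormedAddCommGroup F] [NormedSpace 𝕜 F]
    (𝒰 : Set (Submodule 𝕜 F)) : Prop :=
  ∀ V : Submodule 𝕜 E, IsClosed (V : Set E) → ¬ FiniteDimensional 𝕜 V →
    ∃ U : Submodule 𝕜 E, U ≤ V ∧ ¬ FiniteDimensional 𝕜 U ∧ U.ClosedComplemented ∧
      ∃ W ∈ 𝒰, Nonempty (U ≃L[𝕜] W)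

end

end UncondBasis

/-!
Idea. By a gliding hump argument every infinite-dimensional subspace `V` of `X` contains a sequence
`v n` that is a small perturbation of a block sequence `u n` starting at indices `k n ≥ j n` and
normalized by `‖u n‖ = ‖b (k n)‖`. The basis vectors `b (k n)` form a block sequence along the same
`k`, so block domination makes both `u n ↦ b (k n)` and `b (k n) ↦ u n` bounded. Precomposed with
the block projections, these maps exhibit the span of `u` as a complemented copy of the span of the
`b (k n)`, and an automorphism of `X` moves `u` to `v`. The span of the coordinate functionals is
covered by the same argument, because block domination passes to the dual basis: a functional `g`
with `‖f‖ ≤ ‖g‖` takes every value of `f`, at the expense of a factor `2` in the norm of the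
argument.
-/

namespace UncondBasis

open Filter Topology Function

section Operators

variable {𝕜 : Type*} [NontriviallyNormedField 𝕜]
variable {E : Type*} [NormedAddCommGroup E] [NormedSpace 𝕜 E]
variable {F : Type*} [NormedAddCommGroup F] [NormedSpace 𝕜 F]
variable {ι : Type*}

theorem exists_hasSum_of_forall_summable [CompleteSpace E] [Countable ι] {T : ι → E →L[𝕜] F}
    (hT : ∀ x, Summable fun i => T i x) : ∃ S : E →L[𝕜] F, ∀ x, HasSum (fun i => T i x) (S x) := by
  have hlim : Tendsto (fun (A : Finset ι) x => (∑ i ∈ A, T i) x) atTop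
      (𝓝 fun x => ∑' i, T i x) := by
    refine tendsto_pi_nhds.2 fun x => ?_
    simpa only [_root_.sum_apply] using! (hT x).hasSum
  exact ⟨continuousLinearMapOfTendsto _ hlim, fun x => (hT x).hasSum⟩

theorem exists_norm_le_two_mul_and_apply_eq {f g : StrongDual 𝕜 E} (hfg : ‖f‖ ≤ ‖g‖) (x : E) :
    ∃ z, ‖z‖ ≤ 2 * ‖x‖ ∧ g z = f x := by
  rcases (norm_nonneg g).eq_or_lt with hg | hg
  · have hf : f = 0 := norm_le_zero_iff.1 (hfg.trans hg.ge)
    exact ⟨0, by simp, by simp [hf]⟩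
  obtain ⟨y, hy⟩ := g.exists_mul_lt_of_lt_opNorm (half_pos hg).le (half_lt_self hg)
  have hgy : 0 < ‖g y‖ := lt_of_le_of_lt (by positivity) hy
  refine ⟨(f x / g y) • y, ?_, ?_⟩
  · rw [norm_smul, norm_div, div_mul_eq_mul_div, div_le_iff₀ hgy]
    calc ‖f x‖ * ‖y‖ ≤ ‖g‖ * ‖x‖ * ‖y‖ := by
          gcongr
          exact f.le_of_opNorm_le hfg x
      _ = 2 * ‖x‖ * (‖g‖ / 2 * ‖y‖) := by ring
      _ ≤ 2 * ‖x‖ * ‖g y‖ := by gcongr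
  · rw [map_smul, smul_eq_mul, div_mul_cancel₀ _ (norm_pos_iff.1 hgy)]

theorem exists_continuousLinearEquiv_of_small_perturbation [CompleteSpace E] {u v : ι → E}
    {φ : ι → StrongDual 𝕜 E} (hφ : ∀ n, φ n (u n) = 1) (hφ' : ∀ m n, m ≠ n → φ m (u n) = 0)
    {ε : ι → ℝ} {s : ℝ} (huv : ∀ n, ‖φ n‖ * ‖v n - u n‖ ≤ ε n) (hε : HasSum ε s) (hs : s < 1) :
    ∃ A : E ≃L[𝕜] E, ∀ n, A (u n) = v n := by
  let T : ι → E →L[𝕜] E := fun n => (φ n).smulRight (u n - v n)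
  have hT : ∀ n, ‖T n‖ ≤ ε n := fun n => by
    rw [ContinuousLinearMap.norm_smulRight_apply, norm_sub_rev]
    exact huv n
  have hsum : Summable T := .of_norm_bounded hε.summable hT
  have hTu : ∀ n, (∑' m, T m) (u n) = u n - v n := fun n => by
    refine ((ContinuousLinearMap.apply 𝕜 E (u n)).hasSum hsum.hasSum).unique ?_
    convert hasSum_single n fun m hm => ?_ using 1
    · simp [T, hφ]
    · simp [T, hφ' m n hm]
  refine ⟨ContinuousLinearEquiv.unitsEquiv 𝕜 E
    (Units.oneSub _ ((tsum_of_norm_bounded hε hT).trans_lt hs)), fun n => ?_⟩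
  simp [hTu]

end Operators

theorem summable_sum_of_pairwise_disjoint {ι β E : Type*} [NormedAddCommGroup E] [CompleteSpace E]
    {f : β → E} (hf : Summable f) {B : ι → Finset β} (hB : Pairwise (Disjoint on B)) :
    Summable fun n => ∑ i ∈ B n, f i := by
  have hinj : Injective fun p : Σ n, B n => (p.2 : β) := by
    rintro ⟨m, i, hi⟩ ⟨n, _, hi'⟩ rfl
    obtain rfl : m = n := by
      by_contra hmn
      exact Finset.disjoint_left.1 (hB hmn) hi hi'
    rfl
  refine (hf.comp_injective hinj).sigma.congr fun n => ?_
  rw [tsum_fintype]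
  exact Finset.sum_coe_sort (B n) f

section ClosedSpan

variable {𝕜 : Type*} [RCLike 𝕜]
variable {E : Type*} [NormedAddCommGroup E] [NormedSpace 𝕜 E]
variable {F : Type*} [NormedAddCommGroup F] [NormedSpace 𝕜 F]

theorem isClosed_closedSpan (v : ℕ → E) : IsClosed (closedSpan (𝕜 := 𝕜) v : Set E) :=
  Submodule.isClosed_topologicalClosure _

theorem mem_closedSpan (v : ℕ → E) (n : ℕ) : v n ∈ closedSpan (𝕜 := 𝕜) v :=
  Submodule.le_topologicalClosure _ (Submodule.subset_span ⟨n, rfl⟩)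

theorem closedSpan_le {v : ℕ → E} {V : Submodule 𝕜 E} (hV : IsClosed (V : Set E))
    (hv : ∀ n, v n ∈ V) : closedSpan (𝕜 := 𝕜) v ≤ V :=
  Submodule.topologicalClosure_minimal _ (Submodule.span_le.2 (Set.range_subset_iff.2 hv)) hV

theorem hasSum_mem_closedSpan {v : ℕ → E} {c : ℕ → 𝕜} {x : E}
    (h : HasSum (fun n => c n • v n) x) : x ∈ closedSpan (𝕜 := 𝕜) v :=
  (isClosed_closedSpan v).mem_of_tendsto h <| .of_forall fun _ =>
    Submodule.sum_mem _ fun n _ => Submodule.smul_mem _ _ (mem_closedSpan v n)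

theorem not_finiteDimensional_closedSpan {v : ℕ → E} (hv : LinearIndependent 𝕜 v) :
    ¬ FiniteDimensional 𝕜 (closedSpan (𝕜 := 𝕜) v) := by
  intro _
  have h : LinearIndependent 𝕜 fun n => (⟨v n, mem_closedSpan v n⟩ : closedSpan (𝕜 := 𝕜) v) :=
    .of_comp (closedSpan (𝕜 := 𝕜) v).subtype hv
  exact not_finite_iff_infinite.2 inferInstance h.finite

theorem closedSpan_comp_linearIsometry [CompleteSpace E] (f : E →ₗᵢ[𝕜] F) (v : ℕ → E) :
    closedSpan (𝕜 := 𝕜) (f ∘ v) = (closedSpan (𝕜 := 𝕜) v).map f.toLinearMap := by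
  apply SetLike.coe_injective
  rw [closedSpan, Set.range_comp, ← f.coe_toLinearMap, ← Submodule.map_span]
  exact f.isometry.isClosedEmbedding.closure_image_eq _

theorem nonempty_closedSpan_equiv_comp [CompleteSpace E] (f : E →ₗᵢ[𝕜] F) (v : ℕ → E) :
    Nonempty (closedSpan (𝕜 := 𝕜) v ≃L[𝕜] closedSpan (𝕜 := 𝕜) (f ∘ v)) := by
  rw [closedSpan_comp_linearIsometry]
  refine ⟨(LinearIsometryEquiv.ofSurjective (f.submoduleMap _) ?_).toContinuousLinearEquiv⟩
  rintro ⟨_, y, hy, rfl⟩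
  exact ⟨⟨y, hy⟩, rfl⟩

theorem tendsto_apply_of_mem_closedSpan {ι : Type*} {l : Filter ι} {T : ι → E →L[𝕜] F}
    {S : E →L[𝕜] F} {K : ℝ} (hT : ∀ i, ‖T i‖ ≤ K) {v : ℕ → E}
    (hv : ∀ n, Tendsto (fun i => T i (v n)) l (𝓝 (S (v n)))) {x : E}
    (hx : x ∈ closedSpan (𝕜 := 𝕜) v) : Tendsto (fun i => T i x) l (𝓝 (S x)) := by
  let V : Submodule 𝕜 E :=
    { carrier := {x | Tendsto (fun i => T i x) l (𝓝 (S x))}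
      zero_mem' := by simpa using tendsto_const_nhds
      add_mem' := fun hx hy => by simpa using Tendsto.add hx hy
      smul_mem' := fun c x hx => by simpa using Tendsto.const_smul hx c }
  have hequi : Equicontinuous ((↑) ∘ T) :=
    ((NormedSpace.equicontinuous_TFAE T).out 5 1 :).1 ⟨K, hT⟩
  have hV : IsClosed (V : Set E) := hequi.isClosed_setOfPred_tendsto S.continuous
  exact closedSpan_le hV hv hx

theorem IsSubprojectiveFor.of_equiv {F' : Type*} [NormedAddCommGroup F'] [NormedSpace 𝕜 F']
    {𝒰 : Set (Submodule 𝕜 F)} {𝒰' : Set (Submodule 𝕜 F')} (h : IsSubprojectiveFor 𝕜 E 𝒰)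
    (h𝒰 : ∀ W ∈ 𝒰, ∃ W' ∈ 𝒰', Nonempty (W ≃L[𝕜] W')) : IsSubprojectiveFor 𝕜 E 𝒰' := by
  intro V hVc hV
  obtain ⟨U, hUV, hUfin, hUc, W, hW, ⟨e⟩⟩ := h V hVc hV
  obtain ⟨W', hW', ⟨e'⟩⟩ := h𝒰 W hW
  exact ⟨U, hUV, hUfin, hUc, W', hW', ⟨e.trans e'⟩⟩

end ClosedSpan

section Blocks

variable {𝕜 : Type*} [RCLike 𝕜]
variable {X : Type*} [NormedAddCommGroup X] [NormedSpace 𝕜 X]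
variable (b : UnconditionalSchauderBasis ℕ 𝕜 X)

theorem supp_smul_subset (c : 𝕜) (x : X) : supp b (c • x) ⊆ supp b x := by
  intro i hi h
  exact hi (by simp [h])

theorem coord_proj (A : Finset ℕ) (x : X) (i : ℕ) :
    b.coord i (b.proj A x) = if i ∈ A then b.coord i x else 0 := by
  simp [b.ortho, Pi.single_apply]

theorem supp_proj_subset (A : Finset ℕ) (x : X) : supp b (b.proj A x) ⊆ A := by
  intro i hi
  by_contra h
  exact hi (by rw [coord_proj, if_neg (by simpa using h)])

variable {b} in
theorem proj_eq_self_of_supp_subset {A : Finset ℕ} {x : X} (h : supp b x ⊆ A) :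
    b.proj A x = x := by
  rw [GeneralSchauderBasis.proj_apply]
  refine (hasSum_sum_of_ne_finset_zero fun i hi => ?_).unique (b.expansion x)
  rw [of_not_not fun hx => hi (h hx), zero_smul]

variable {b} in
theorem proj_eq_zero_of_supp_disjoint {A : Finset ℕ} {x : X} (h : Disjoint (supp b x) A) :
    b.proj A x = 0 := by
  rw [GeneralSchauderBasis.proj_apply]
  refine Finset.sum_eq_zero fun i hi => ?_
  rw [of_not_not fun hx => Set.disjoint_left.1 h hx hi, zero_smul]

theorem norm_proj_apply_le [CompleteSpace X] (A : Finset ℕ) (x : X) :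
    ‖b.proj A x‖ ≤ b.nnnormProjBound * ‖x‖ :=
  (b.proj A).le_of_opNorm_le (b.norm_proj_le_nnnormProjBound A) x

/-- The projection onto the span of the `n`-th block `b (k n), …, b (k (n + 1) - 1)`. -/
noncomputable def blockProj (k : ℕ → ℕ) (n : ℕ) : X →L[𝕜] X :=
  b.proj (Finset.Ico (k n) (k (n + 1)))

theorem pairwise_disjoint_finset_Ico {k : ℕ → ℕ} (hk : Monotone k) :
    Pairwise (Disjoint on fun n => Finset.Ico (k n) (k (n + 1))) := fun m n hmn => by
  simpa [onFun, ← Finset.disjoint_coe] using hk.pairwise_disjoint_on_Ico_succ hmn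

theorem norm_sum_blockProj_le [CompleteSpace X] {k : ℕ → ℕ} (hk : Monotone k) (A : Finset ℕ)
    (x : X) : ‖∑ n ∈ A, blockProj b k n x‖ ≤ b.nnnormProjBound * ‖x‖ := by
  have hsum : ∑ n ∈ A, blockProj b k n x =
      b.proj (A.biUnion fun n => Finset.Ico (k n) (k (n + 1))) x := by
    simp only [blockProj, GeneralSchauderBasis.proj_apply]
    exact (Finset.sum_biUnion ((pairwise_disjoint_finset_Ico hk).set_pairwise _)).symm
  rw [hsum]
  exact norm_proj_apply_le b _ x

theorem summable_blockProj [CompleteSpace X] {k : ℕ → ℕ} (hk : Monotone k) (x : X) :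
    Summable fun n => blockProj b k n x := by
  simp only [blockProj, GeneralSchauderBasis.proj_apply]
  exact summable_sum_of_pairwise_disjoint (b.expansion x).summable (pairwise_disjoint_finset_Ico hk)

/-- `u` is a block sequence of the basis `b` along `k`: its terms are supported on the consecutive
intervals `[k n, k (n + 1) - 1]`. Zero terms are allowed. -/
structure IsBlockSeq (k : ℕ → ℕ) (u : ℕ → X) : Prop where
  strictMono : StrictMono k
  supp_subset : ∀ n, supp b (u n) ⊆ Set.Ico (k n) (k (n + 1))

theorem isBlockSeq_blockProj {k : ℕ → ℕ} (hk : StrictMono k) (x : ℕ → X) :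
    IsBlockSeq b k fun n => blockProj b k n (x n) :=
  ⟨hk, fun n => by
    simpa only [Finset.coe_Ico] using! supp_proj_subset b (Finset.Ico (k n) (k (n + 1))) (x n)⟩

theorem isBlockSeq_basis {k : ℕ → ℕ} (hk : StrictMono k) : IsBlockSeq b k fun n => b (k n) := by
  refine ⟨hk, fun n i hi => ?_⟩
  obtain rfl : i = k n := by
    by_contra h
    exact hi (by simp [b.ortho, h])
  exact ⟨le_rfl, hk n.lt_succ_self⟩

namespace IsBlockSeq

variable {b} {k : ℕ → ℕ} {u w : ℕ → X}

theorem smul (hu : IsBlockSeq b k u) (c : ℕ → 𝕜) : IsBlockSeq b k fun n => c n • u n :=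
  ⟨hu.strictMono, fun n => (supp_smul_subset b _ _).trans (hu.supp_subset n)⟩

theorem blockProj_self (hu : IsBlockSeq b k u) (n : ℕ) : blockProj b k n (u n) = u n :=
  proj_eq_self_of_supp_subset (by simpa using hu.supp_subset n)

theorem blockProj_of_ne (hu : IsBlockSeq b k u) {m n : ℕ} (hmn : m ≠ n) :
    blockProj b k m (u n) = 0 := by
  refine proj_eq_zero_of_supp_disjoint (Set.disjoint_of_subset_left (hu.supp_subset n) ?_)
  simpa using hu.strictMono.monotone.pairwise_disjoint_on_Ico_succ hmn.symm

theorem blockProj_eq_of_hasSum (hu : IsBlockSeq b k u) {x : X} (hx : HasSum u x) (n : ℕ) :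
    blockProj b k n x = u n := by
  refine ((blockProj b k n).hasSum hx).unique ?_
  simpa only [hu.blockProj_self n] using
    hasSum_single n fun m (hm : m ≠ n) => hu.blockProj_of_ne hm.symm

theorem exists_biorthogonal (hu : IsBlockSeq b k u) (hu0 : ∀ n, u n ≠ 0) :
    ∃ φ : ℕ → StrongDual 𝕜 X, (∀ n, φ n (u n) = 1) ∧ (∀ m n, m ≠ n → φ m (u n) = 0) ∧
      ∀ n x, ‖φ n x‖ * ‖u n‖ ≤ ‖blockProj b k n x‖ := by
  have hnorm : ∀ n, ‖u n‖ ≠ 0 := fun n => norm_ne_zero_iff.2 (hu0 n)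
  choose ψ hψ hψu using fun n => exists_dual_vector 𝕜 (u n) (hnorm n)
  refine ⟨fun n => (‖u n‖⁻¹ : 𝕜) • (ψ n).comp (blockProj b k n), fun n => ?_, fun m n hmn => ?_,
    fun n x => ?_⟩
  · simp [hu.blockProj_self, hψu, hu0]
  · simp [hu.blockProj_of_ne hmn]
  · calc ‖(‖u n‖⁻¹ : 𝕜) • ψ n (blockProj b k n x)‖ * ‖u n‖ = ‖ψ n (blockProj b k n x)‖ := by
          simp [mul_comm, hnorm n]
      _ ≤ ‖blockProj b k n x‖ := by simpa [hψ n] using (ψ n).le_opNorm (blockProj b k n x)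

end IsBlockSeq

end Blocks

section GlidingHump

variable {𝕜 : Type*} [RCLike 𝕜]
variable {X : Type*} [NormedAddCommGroup X] [NormedSpace 𝕜 X]
variable (b : UnconditionalSchauderBasis ℕ 𝕜 X) {V : Submodule 𝕜 X}

theorem exists_mem_ne_zero_coord_eq_zero (hV : ¬ FiniteDimensional 𝕜 V) (N : ℕ) :
    ∃ v ∈ V, v ≠ 0 ∧ ∀ i < N, b.coord i v = 0 := by
  let Φ : V →ₗ[𝕜] (Fin N → 𝕜) := LinearMap.pi fun i => (b.coord i).toLinearMap.comp V.subtype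
  have hΦ : Φ.ker ≠ ⊥ := fun h => hV (.of_injective Φ (LinearMap.ker_eq_bot.1 h))
  obtain ⟨v, hv, hv0⟩ := (Submodule.ne_bot_iff _).1 hΦ
  exact ⟨v, v.2, by simpa using hv0, fun i hi => congrFun (LinearMap.mem_ker.1 hv) ⟨i, hi⟩⟩

theorem exists_block_near (hV : ¬ FiniteDimensional 𝕜 V) (N : ℕ) {r ε : ℝ} (hr : 0 < r)
    (hε : 0 < ε) :
    ∃ M > N, ∃ u, ∃ v ∈ V, supp b u ⊆ Set.Ico N M ∧ ‖u‖ = r ∧ ‖v - u‖ < ε * ‖u‖ := by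
  obtain ⟨v, hvV, hv0, hv⟩ := exists_mem_ne_zero_coord_eq_zero b hV N
  have hlim : Tendsto (fun M => b.proj (Finset.range M) v) atTop (𝓝 v) :=
    (b.tendsto_proj v).comp tendsto_finset_range
  have hdiff : Tendsto (fun M => ‖v - b.proj (Finset.range M) v‖) atTop (𝓝 0) := by
    simpa only [sub_self, norm_zero] using ((tendsto_const_nhds (x := v)).sub hlim).norm
  have hnear : ∀ᶠ M in atTop, ‖v - b.proj (Finset.range M) v‖ < ε * ‖b.proj (Finset.range M) v‖ :=
    hdiff.eventually_lt (hlim.norm.const_mul ε) (by positivity)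
  obtain ⟨M, hM, hNM⟩ := (hnear.and (eventually_gt_atTop N)).exists
  set p := b.proj (Finset.range M) v with hp
  have hp0 : 0 < ‖p‖ := pos_of_mul_pos_right ((norm_nonneg _).trans_lt hM) hε.le
  have hsupp : supp b p ⊆ Set.Ico N M := fun i hi => by
    have hiM : i ∈ Finset.range M := supp_proj_subset b _ v hi
    refine ⟨not_lt.1 fun hiN => hi ?_, Finset.mem_range.1 hiM⟩
    rw [hp, coord_proj, if_pos hiM, hv i hiN]
  have hc : ‖((r / ‖p‖ : ℝ) : 𝕜)‖ = r / ‖p‖ := by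
    rw [RCLike.norm_ofReal, abs_of_pos (by positivity)]
  refine ⟨M, hNM, ((r / ‖p‖ : ℝ) : 𝕜) • p, ((r / ‖p‖ : ℝ) : 𝕜) • v, V.smul_mem _ hvV,
    (supp_smul_subset b _ _).trans hsupp, ?_, ?_⟩
  · rw [norm_smul, hc, div_mul_cancel₀ _ hp0.ne']
  · rw [← smul_sub, norm_smul, norm_smul, hc, mul_left_comm]
    gcongr

theorem exists_isBlockSeq_near (hV : ¬ FiniteDimensional 𝕜 V) (j : ℕ → ℕ) {r ε : ℕ → ℝ}
    (hr : ∀ n, 0 < r n) (hε : ∀ n, 0 < ε n) :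
    ∃ (k : ℕ → ℕ) (u v : ℕ → X), IsBlockSeq b k u ∧ (∀ n, j n ≤ k n) ∧ (∀ n, v n ∈ V) ∧
      (∀ n, ‖u n‖ = r (k n)) ∧ ∀ n, ‖v n - u n‖ < ε n * ‖u n‖ := by
  choose M hM u v hv hsupp hu huv using
    fun n N : ℕ => exists_block_near b hV N (hr N) (hε n)
  let k : ℕ → ℕ := fun n => Nat.rec (j 0) (fun n N => max (M n N) (j (n + 1))) n
  have hMk : ∀ n, M n (k n) ≤ k (n + 1) := fun n => le_max_left _ _
  have hjk : ∀ n, j n ≤ k n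
    | 0 => le_rfl
    | _ + 1 => le_max_right _ _
  have hk : StrictMono k := strictMono_nat_of_lt_succ fun n => (hM n (k n)).trans_le (hMk n)
  exact ⟨k, fun n => u n (k n), fun n => v n (k n),
    ⟨hk, fun n => (hsupp n _).trans (Set.Ico_subset_Ico_right (hMk n))⟩, hjk,
    fun n => hv n _, fun n => hu n _, fun n => huv n _⟩

theorem exists_isBlockSeq_equiv_mem [CompleteSpace X] (hV : ¬ FiniteDimensional 𝕜 V) (j : ℕ → ℕ)
    {r : ℕ → ℝ} (hr : ∀ n, 0 < r n) :
    ∃ (k : ℕ → ℕ) (u : ℕ → X) (A : X ≃L[𝕜] X), IsBlockSeq b k u ∧ (∀ n, j n ≤ k n) ∧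
      (∀ n, ‖u n‖ = r (k n)) ∧ ∀ n, A (u n) ∈ V := by
  set K : ℝ := ((b.nnnormProjBound : NNReal) : ℝ)
  obtain ⟨ε, hε, s, hεs, hs⟩ := NNReal.exists_pos_sum_of_countable one_ne_zero ℕ
  obtain ⟨k, u, v, hu, hjk, hv, hunorm, huv⟩ := exists_isBlockSeq_near b hV j hr
    (ε := fun n => ε n / (K + 1)) fun n => div_pos (hε n) (by positivity)
  have hu0 : ∀ n, 0 < ‖u n‖ := fun n => hunorm n ▸ hr _
  obtain ⟨φ, hφ, hφ', hφu⟩ := hu.exists_biorthogonal fun n => norm_pos_iff.1 (hu0 n)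
  have hφnorm : ∀ n, ‖φ n‖ * ‖u n‖ ≤ K := fun n => by
    rw [← le_div_iff₀ (hu0 n)]
    refine (φ n).opNorm_le_bound (by positivity) fun x => ?_
    rw [div_mul_eq_mul_div, le_div_iff₀ (hu0 n)]
    exact (hφu n x).trans (norm_proj_apply_le b _ x)
  have hpert : ∀ n, ‖φ n‖ * ‖v n - u n‖ ≤ ε n := fun n =>
    calc ‖φ n‖ * ‖v n - u n‖ ≤ ‖φ n‖ * (ε n / (K + 1) * ‖u n‖) := by gcongr; exact (huv n).le
      _ = ‖φ n‖ * ‖u n‖ * (ε n / (K + 1)) := by ring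
      _ ≤ (K + 1) * (ε n / (K + 1)) := by gcongr; linarith [hφnorm n]
      _ = ε n := mul_div_cancel₀ _ (by positivity)
  obtain ⟨A, hA⟩ := exists_continuousLinearEquiv_of_small_perturbation hφ hφ' hpert
    (NNReal.hasSum_coe.2 hεs) hs
  exact ⟨k, u, A, hu, hjk, hunorm, fun n => hA n ▸ hv n⟩

end GlidingHump

section Domination

variable {𝕜 : Type*} [RCLike 𝕜]
variable {X : Type*} [NormedAddCommGroup X] [NormedSpace 𝕜 X]
variable {b : UnconditionalSchauderBasis ℕ 𝕜 X} {C : ℝ} {j k : ℕ → ℕ} {u w : ℕ → X}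

namespace BlockDomination

theorem norm_sum_le (hdom : BlockDomination b C j) (hjk : ∀ n, j n ≤ k n) (hu : IsBlockSeq b k u)
    (hw : IsBlockSeq b k w) (hwu : ∀ n, ‖w n‖ ≤ ‖u n‖) (A : Finset ℕ) :
    ‖∑ n ∈ A, w n‖ ≤ |C| * ‖∑ n ∈ A, u n‖ := by
  let c : ℕ → 𝕜 := (A : Set ℕ).indicator 1
  have hsum : ∀ f : ℕ → X, HasSum (fun n => c n • f n) (∑ n ∈ A, f n) := fun f => by
    convert hasSum_sum_of_ne_finset_zero (L := .unconditional ℕ) (s := A) fun n hn => ?_ using 1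
    · exact Finset.sum_congr rfl fun n hn => by simp [c, hn]
    · simp [c, hn]
  refine (hdom k _ _ _ _ hu.strictMono hjk (fun n => ?_)
    (fun n => Set.union_subset ((hw.smul c).supp_subset n) ((hu.smul c).supp_subset n))
    (hsum w) (hsum u)).trans (by gcongr; exact le_abs_self C)
  rw [norm_smul, norm_smul]
  gcongr
  exact hwu n

variable [CompleteSpace X]

theorem summable (hdom : BlockDomination b C j) (hjk : ∀ n, j n ≤ k n) (hu : IsBlockSeq b k u)
    (hw : IsBlockSeq b k w) (hwu : ∀ n, ‖w n‖ ≤ ‖u n‖) (hsum : Summable u) : Summable w := by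
  rw [summable_iff_vanishing_norm] at hsum ⊢
  intro ε hε
  obtain ⟨s, hs⟩ := hsum (ε / (|C| + 1)) (by positivity)
  refine ⟨s, fun t ht => ?_⟩
  calc ‖∑ n ∈ t, w n‖ ≤ |C| * ‖∑ n ∈ t, u n‖ := hdom.norm_sum_le hjk hu hw hwu t
    _ ≤ (|C| + 1) * ‖∑ n ∈ t, u n‖ := by gcongr; linarith
    _ < ε := (lt_div_iff₀' (by positivity)).1 (hs t ht)

theorem exists_map_isBlockSeq (hdom : BlockDomination b C j) (hjk : ∀ n, j n ≤ k n)
    (hu : IsBlockSeq b k u) (hw : IsBlockSeq b k w) (hu0 : ∀ n, u n ≠ 0)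
    (hwu : ∀ n, ‖w n‖ ≤ ‖u n‖) :
    ∃ T : X →L[𝕜] X, (∀ n, T (u n) = w n) ∧ ∀ x, T x ∈ closedSpan (𝕜 := 𝕜) w := by
  obtain ⟨φ, hφ, hφ', hφu⟩ := hu.exists_biorthogonal hu0
  have hle : ∀ x n, ‖φ n x • w n‖ ≤ ‖blockProj b k n x‖ := fun x n => by
    rw [norm_smul]
    exact le_trans (by gcongr; exact hwu n) (hφu n x)
  have hsum : ∀ x, Summable fun n => (φ n).smulRight (w n) x := fun x =>
    hdom.summable hjk (isBlockSeq_blockProj b hu.strictMono fun _ => x) (hw.smul _) (hle x)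
      (summable_blockProj b hu.strictMono.monotone x)
  obtain ⟨T, hT⟩ := exists_hasSum_of_forall_summable hsum
  refine ⟨T, fun n => (hT (u n)).unique ?_, fun x => hasSum_mem_closedSpan (hT x)⟩
  convert hasSum_single n fun m hm => ?_ using 1
  · simp [hφ]
  · rw [ContinuousLinearMap.smulRight_apply, hφ' m n hm, zero_smul]

theorem exists_hasLeftInverse (hdom : BlockDomination b C j) (hjk : ∀ n, j n ≤ k n)
    (hu : IsBlockSeq b k u) (hw : IsBlockSeq b k w) (hu0 : ∀ n, u n ≠ 0)
    (hwu : ∀ n, ‖w n‖ = ‖u n‖) :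
    ∃ S : closedSpan (𝕜 := 𝕜) w →L[𝕜] X, S.HasLeftInverse ∧
      ∀ x, S x ∈ closedSpan (𝕜 := 𝕜) u := by
  have hw0 : ∀ n, w n ≠ 0 := fun n =>
    norm_ne_zero_iff.1 (hwu n ▸ norm_ne_zero_iff.2 (hu0 n))
  obtain ⟨T, hT, hTmem⟩ := hdom.exists_map_isBlockSeq hjk hw hu hw0 fun n => (hwu n).ge
  obtain ⟨R, hR, hRmem⟩ := hdom.exists_map_isBlockSeq hjk hu hw hu0 fun n => (hwu n).le
  have hRT : Set.EqOn (R.comp T) (ContinuousLinearMap.id 𝕜 X) (closedSpan (𝕜 := 𝕜) w) := by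
    refine ContinuousLinearMap.eqOn_closure_span ?_
    rintro _ ⟨n, rfl⟩
    exact (congrArg R (hT n)).trans (hR n)
  exact ⟨T.comp (Submodule.subtypeL _), ⟨R.codRestrict _ hRmem, fun x => Subtype.ext (hRT x.2)⟩,
    fun x => hTmem x⟩

theorem isSubprojectiveFor (hdom : BlockDomination b C j) :
    IsSubprojectiveFor 𝕜 X (subbasisSpans 𝕜 b.basis j) := by
  intro V hVc hV
  have hb0 : ∀ i, 0 < ‖b i‖ := fun i => norm_pos_iff.2 (b.linearIndependent.ne_zero i)
  obtain ⟨k, u, A, hu, hjk, hunorm, hAu⟩ := exists_isBlockSeq_equiv_mem b hV j hb0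
  have hu0 : ∀ n, u n ≠ 0 := fun n => norm_pos_iff.1 (hunorm n ▸ hb0 _)
  obtain ⟨S, hS, hSu⟩ := hdom.exists_hasLeftInverse hjk hu (isBlockSeq_basis b hu.strictMono) hu0
    fun n => (hunorm n).symm
  have hAS : ((A : X →L[𝕜] X).comp S).HasLeftInverse := hS.continuousLinearEquivalence_comp
  let W : Submodule 𝕜 X := closedSpan fun n => b (k n)
  have : CompleteSpace W := (isClosed_closedSpan _).completeSpace_coe
  let e : W ≃L[𝕜] ((A : X →L[𝕜] X).comp S).range :=
    ContinuousLinearMap.equivRange hAS.injective hAS.isClosed_range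
  have hrange : ((A : X →L[𝕜] X).comp S).range ≤ V := by
    rintro _ ⟨x, rfl⟩
    exact closedSpan_le (V := V.comap A.toLinearMap) (hVc.preimage A.continuous) hAu (hSu x)
  refine ⟨_, hrange, fun _ => ?_, hAS.closedComplemented_range, W, ⟨k, hu.strictMono, hjk, rfl⟩,
    ⟨e.symm⟩⟩
  exact not_finiteDimensional_closedSpan (b.linearIndependent.comp k hu.strictMono.injective)
    (e.symm.toLinearEquiv.finiteDimensional)

end BlockDomination

end Domination

section Dual

variable {𝕜 : Type*} [RCLike 𝕜]
variable {X : Type*} [NormedAddCommGroup X] [NormedSpace 𝕜 X] [CompleteSpace X]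
variable (b : UnconditionalSchauderBasis ℕ 𝕜 X)

theorem hasSum_coord_of_mem_closedSpan {y : StrongDual 𝕜 X}
    (hy : y ∈ closedSpan (𝕜 := 𝕜) b.coord) : HasSum (fun i => y (b i) • b.coord i) y := by
  let T : Finset ℕ → StrongDual 𝕜 X →L[𝕜] StrongDual 𝕜 X :=
    fun A => ContinuousLinearMap.precomp 𝕜 (b.proj A)
  have hT : ∀ A, ‖T A‖ ≤ b.nnnormProjBound := fun A =>
    (T A).opNorm_le_bound (NNReal.coe_nonneg _) fun z => by
      rw [mul_comm]
      exact (z.opNorm_comp_le _).trans (by gcongr; exact b.norm_proj_le_nnnormProjBound A)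
  have hsum : ∀ A, T A y = ∑ i ∈ A, y (b i) • b.coord i := fun A => by
    ext x
    simp [T, _root_.sum_apply, mul_comm]
  have hcoord : ∀ n, Tendsto (fun A => T A (b.coord n)) atTop (𝓝 (b.coord n)) := fun n => by
    refine tendsto_const_nhds.congr' ?_
    filter_upwards [eventually_ge_atTop {n}] with A hA
    ext x
    exact (by rw [coord_proj, if_pos (hA (Finset.mem_singleton_self n))] :
      b.coord n (b.proj A x) = b.coord n x).symm
  have hlim := tendsto_apply_of_mem_closedSpan (S := .id 𝕜 _) hT hcoord hy
  simpa only [hsum] using! hlim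

/-- The coordinate functionals of `b`, as an unconditional basis of their closed linear span. -/
noncomputable def dualBasis : UnconditionalSchauderBasis ℕ 𝕜 (closedSpan (𝕜 := 𝕜) b.coord) where
  basis i := ⟨b.coord i, mem_closedSpan b.coord i⟩
  coord i := (ContinuousLinearMap.apply 𝕜 𝕜 (b i)).comp (Submodule.subtypeL _)
  ortho i m := by simp [b.ortho, Pi.single_apply, eq_comm]
  expansion y := by
    rw [← Topology.IsInducing.subtypeVal.hasSum_iff (g := Submodule.subtype _)]
    exact hasSum_coord_of_mem_closedSpan b y.2

theorem dualBasis_blockProj_apply (k : ℕ → ℕ) (n : ℕ) (y : closedSpan (𝕜 := 𝕜) b.coord) (x : X) :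
    (blockProj (dualBasis b) k n y).1 x = y.1 (blockProj b k n x) := by
  simp [blockProj, dualBasis, _root_.sum_apply, mul_comm]

variable {b} {C : ℝ} {j : ℕ → ℕ}

namespace BlockDomination

theorem dualBasis (hdom : BlockDomination b C j) :
    BlockDomination (dualBasis b) (|C| * (2 * b.nnnormProjBound ^ 2)) j := by
  intro k f g F G hk hjk hfg hsupp hF hG
  set K : ℝ := ((b.nnnormProjBound : NNReal) : ℝ)
  have hf : IsBlockSeq (UncondBasis.dualBasis b) k f :=
    ⟨hk, fun n => (Set.union_subset_iff.1 (hsupp n)).1⟩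
  have hg : IsBlockSeq (UncondBasis.dualBasis b) k g :=
    ⟨hk, fun n => (Set.union_subset_iff.1 (hsupp n)).2⟩
  refine ContinuousLinearMap.opNorm_le_bound F.1 (by positivity) fun x => ?_
  choose z hz hgz using fun n => exists_norm_le_two_mul_and_apply_eq (hfg n) (blockProj b k n x)
  let y : ℕ → X := fun n => blockProj b k n (z n)
  have hfy : ∀ n, (f n).1 x = G.1 (y n) := fun n =>
    calc (f n).1 x = (f n).1 (blockProj b k n x) := by
          rw [← dualBasis_blockProj_apply, hf.blockProj_self]
      _ = (g n).1 (z n) := (hgz n).symm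
      _ = G.1 (y n) := by rw [← dualBasis_blockProj_apply, hg.blockProj_eq_of_hasSum hG]
  have hy : ∀ n, ‖y n‖ ≤ ‖((2 * K : ℝ) : 𝕜) • blockProj b k n x‖ := fun n =>
    calc ‖y n‖ ≤ K * ‖z n‖ := norm_proj_apply_le b _ _
      _ ≤ K * (2 * ‖blockProj b k n x‖) := by gcongr; exact hz n
      _ = ‖((2 * K : ℝ) : 𝕜) • blockProj b k n x‖ := by
          rw [norm_smul, RCLike.norm_of_nonneg (by positivity)]
          ring
  have hsum : ∀ A : Finset ℕ, ‖∑ n ∈ A, y n‖ ≤ |C| * (2 * K ^ 2) * ‖x‖ := fun A =>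
    calc ‖∑ n ∈ A, y n‖ ≤ |C| * ‖∑ n ∈ A, ((2 * K : ℝ) : 𝕜) • blockProj b k n x‖ :=
          hdom.norm_sum_le hjk ((isBlockSeq_blockProj b hk fun _ => x).smul _)
            (isBlockSeq_blockProj b hk z) hy A
      _ = |C| * (2 * K * ‖∑ n ∈ A, blockProj b k n x‖) := by
          rw [← Finset.smul_sum, norm_smul, RCLike.norm_of_nonneg (by positivity)]
      _ ≤ |C| * (2 * K * (K * ‖x‖)) := by gcongr; exact norm_sum_blockProj_le b hk.monotone A x
      _ = |C| * (2 * K ^ 2) * ‖x‖ := by ring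
  have hFx : HasSum (fun n => (f n).1 x) (F.1 x) :=
    ((ContinuousLinearMap.apply 𝕜 𝕜 x).comp (Submodule.subtypeL _)).hasSum hF
  refine le_of_tendsto hFx.norm (.of_forall fun A => ?_)
  calc ‖∑ n ∈ A, (f n).1 x‖ = ‖G.1 (∑ n ∈ A, y n)‖ := by simp only [hfy, map_sum]
    _ ≤ ‖G‖ * (|C| * (2 * K ^ 2) * ‖x‖) := G.1.le_of_opNorm_le_of_le le_rfl (hsum A)
    _ = |C| * (2 * K ^ 2) * ‖G‖ * ‖x‖ := by ring

theorem isSubprojectiveFor_dual (hdom : BlockDomination b C j) :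
    IsSubprojectiveFor 𝕜 (closedSpan (𝕜 := 𝕜) b.coord) (subbasisSpans 𝕜 b.coord j) := by
  let Y : Submodule 𝕜 (StrongDual 𝕜 X) := closedSpan b.coord
  have : CompleteSpace Y := (isClosed_closedSpan _).completeSpace_coe
  refine hdom.dualBasis.isSubprojectiveFor.of_equiv ?_
  rintro _ ⟨k, hk, hjk, rfl⟩
  exact ⟨_, ⟨k, hk, hjk, rfl⟩, nonempty_closedSpan_equiv_comp Y.subtypeₗᵢ _⟩

end BlockDomination

end Dual

end UncondBasis

theorem theorem3p11 {𝕜 : Type*} [RCLike 𝕜]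
    {X : Type*} [NormedAddCommGroup X] [NormedSpace 𝕜 X] [CompleteSpace X]
    (b : UnconditionalSchauderBasis ℕ 𝕜 X) (C : ℝ) (j : ℕ → ℕ) (hj : Monotone j)
    (hdom : UncondBasis.BlockDomination b C j) :
    UncondBasis.IsSubprojectiveFor 𝕜 X (UncondBasis.subbasisSpans 𝕜 b.basis j) ∧
    UncondBasis.IsSubprojectiveFor 𝕜 (UncondBasis.closedSpan (𝕜 := 𝕜) b.coord)
      (UncondBasis.subbasisSpans 𝕜 b.coord j) :=
  ⟨hdom.isSubprojectiveFor, hdom.isSubprojectiveFor_dual⟩
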